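/- Let $d\ge 1$ and let $\Omega\subset\mathbb R^d$ be a bounded open set (no connectedness or regularity of the boundary is needed, so bounded Lipschitz domains are covered). Let $(\phi_k)_{k\ge1}$ be an orthonormal basis of the real space $L^2(\Omega)$ consisting of eigenfunctions of the Dirichlet Laplacian, with eigenvalues in non-decreasing order $\lambda_1\le\lambda_2\le\cdots$; that is, $\phi_k\in H^1_0(\Omega)$ (the closure of $C_c^\infty(\Omega)$ in $H^1(\Omega)$) and $\int_\Omega\nabla\phi_k\cdot\nabla v\,dx=\lambda_k\int_\Omega\phi_k v\,dx$ for all $v\in C_c^\infty(\Omega)$. For $s\ge 0$ let $$\dot H^s(\Omega)=\Big\{u\in L^2(\Omega):\ \|u\|_{\dot H^s}^2:=\sum_{k\ge1}\lambda_k^s\,|\langle u,\phi_k\rangle_{L^2}|^2<\infty\Big\},$$ and for $s>0$ let $\dot H^{-s}(\Omega)$ be the dual space of all bounded linear functionals $R:\dot H^s(\Omega)\to\mathbb R$ with $\|R\|_{\dot H^{-s}}^2:=\sum_{k\ge1}\lambda_k^{-s}|R(\phi_k)|^2<\infty$. A function $u\in L^2(\Omega)$ is regarded as an element of $\dot H^{-s}(\Omega)$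 through $\varphi\mapsto\langle u,\varphi\rangle_{L^2}$. Let $(w_k)_{k\ge1}$ be independent real random variables with mean zero and variance one on a probability space $(\Xi,\mathfrak F,\mu)$, let $\tau>0$, and put $$\Phi^{(n)}(\xi)=\tau\sum_{k=1}^n(1+\lambda_k)^{-1/2}\,w_k(\xi)\,\phi_k .$$ Then there is a random distribution $\Phi:\Xi\to\mathcal D'(\Omega)$ (meaning that $\xi\mapsto\Phi(\xi)(v)$ is $\mu$-almost everywhere measurable for each $v\in C_c^\infty(\Omega)$) such that, for $\mu$-almost every $\xi$, the following holds for every $\varepsilon>0$, with $t=1-\frac d2-\varepsilon$: all partial sums $\Phi^{(n)}(\xi)$ belong to $\dot H^t(\Omega)$ and converge in the norm of $\dot H^t(\Omega)$, and the limit is $\Phi(\xi)$, which thus lies in $\dot H^t(\Omega)$. More precisely, if $t\ge0$ the limit is a function $u\in\dot H^t(\Omega)$ and $\Phi(\xi)(v)=\int_\Omega u\,v\,dx$ for all $v\in C_c^\infty(\Omega)$; if $t<0$ the limit is a functional $R\in\dot H^{t}(\Omega)$, one has $C_c^\infty(\Omega)\subset\dot H^{|t|}(\Omega)$, and $\Phi(\xi)(v)=R(v)$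 for all $v\in C_c^\infty(\Omega)$. If $d\ge2$, then $t<0$ for every $\varepsilon>0$, so that almost every realisation of $\Phi$ is a distribution in spaces of negative order. -/

import Mathlib

open MeasureTheory ProbabilityTheory Filter Topology TopologicalSpace
open scoped Distributions

namespace StochTest

/-- The Euclidean space `ℝᵈ`. -/
abbrev Euc (d : ℕ) : Type := EuclideanSpace ℝ (Fin d)

/-- The real Hilbert space `L²(Ω)` (Lebesgue measure). -/
abbrev L2 {d : ℕ} (Ω : Opens (Euc d)) : Type :=
  Lp ℝ 2 ((volume : Measure (Euc d)).restrict (Ω : Set (Euc d)))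

/-- A test function `v ∈ C_c^∞(Ω)`, seen as an element of `L²(Ω)`. -/
noncomputable def testL2 {d : ℕ} {Ω : Opens (Euc d)} (v : 𝓓(Ω, ℝ)) : L2 Ω :=
  MemLp.toLp (v : Euc d → ℝ)
    (v.continuous.memLp_of_hasCompactSupport (p := 2) v.hasCompactSupport)

/-- `u ∈ H₀¹(Ω)` with weak gradient `g`: both are square integrable, `g` is the weak gradient of
`u`, and `u` is the limit in the `H¹` norm of a sequence of functions in `C_c^∞(Ω)`. -/
structure IsH10WithGradient {d : ℕ} (Ω : Opens (Euc d)) (u : Euc d → ℝ) (g : Euc d → Euc d) :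
    Prop where
  memLp : MemLp u 2 ((volume : Measure (Euc d)).restrict (Ω : Set (Euc d)))
  memLp_grad : MemLp g 2 ((volume : Measure (Euc d)).restrict (Ω : Set (Euc d)))
  weak_grad : ∀ (η : 𝓓(Ω, ℝ)) (i : Fin d),
    ∫ x in (Ω : Set (Euc d)), u x * fderiv ℝ (η : Euc d → ℝ) x (EuclideanSpace.single i 1)
      = - ∫ x in (Ω : Set (Euc d)), g x i * η x
  approx : ∃ v : ℕ → 𝓓(Ω, ℝ),
    Tendsto (fun n => eLpNorm (fun x => v n x - u x) 2
      ((volume : Measure (Euc d)).restrict (Ω : Set (Euc d)))) atTop (𝓝 0) ∧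
    Tendsto (fun n => eLpNorm (fun x => gradient (v n : Euc d → ℝ) x - g x) 2
      ((volume : Measure (Euc d)).restrict (Ω : Set (Euc d)))) atTop (𝓝 0)

/-- `u ∈ H₀¹(Ω)` is a weak solution of `-Δu = l u` in `Ω`, `u = 0` on `∂Ω`. -/
def IsDirichletEigen {d : ℕ} (Ω : Opens (Euc d)) (l : ℝ) (u : Euc d → ℝ) : Prop :=
  ∃ g : Euc d → Euc d, IsH10WithGradient Ω u g ∧
    ∀ v : 𝓓(Ω, ℝ),
      ∫ x in (Ω : Set (Euc d)), inner ℝ (g x) (gradient (v : Euc d → ℝ) x)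
        = l * ∫ x in (Ω : Set (Euc d)), u x * v x

/-- `(lam, φ)` is a spectral decomposition of the Dirichlet Laplacian on `Ω`: the `φ k` are an
orthonormal basis of `L²(Ω)`, `φ k` is an eigenfunction with eigenvalue `lam k`, and the
eigenvalues are listed in non-decreasing order (indexed from `0`). -/
structure IsDirichletSpectrum {d : ℕ} (Ω : Opens (Euc d)) (lam : ℕ → ℝ)
    (φ : HilbertBasis ℕ ℝ (L2 Ω)) : Prop where
  mono : Monotone lam
  eigen : ∀ k, IsDirichletEigen Ω (lam k) (φ k : L2 Ω)

section Spectral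

/-- The space `Ḣˢ(Ω) = {u ∈ L²(Ω) : ∑ₖ λₖˢ |⟨u, φₖ⟩|² < ∞}`, used for `s ≥ 0`. -/
noncomputable def Hdot {d : ℕ} {Ω : Opens (Euc d)} (lam : ℕ → ℝ)
    (φ : HilbertBasis ℕ ℝ (L2 Ω)) (s : ℝ) : Submodule ℝ (L2 Ω) where
  carrier := {u | Summable fun k => lam k ^ s * |inner ℝ u (φ k)| ^ 2}
  zero_mem' := by simp
  add_mem' := by
    intro a b ha hb
    simp only [Set.mem_ofPred_eq] at ha hb ⊢
    refine Summable.of_norm_bounded ((ha.norm.mul_left 2).add (hb.norm.mul_left 2)) fun k => ?_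
    simp only [norm_mul, Real.norm_eq_abs, inner_add_left, sq_abs, abs_pow]
    have h : (inner ℝ a (φ k) + inner ℝ b (φ k)) ^ 2
        ≤ 2 * (inner ℝ a (φ k)) ^ 2 + 2 * (inner ℝ b (φ k)) ^ 2 := by
      nlinarith [sq_nonneg (inner ℝ a (φ k) - inner ℝ b (φ k))]
    nlinarith [mul_le_mul_of_nonneg_left h (abs_nonneg (lam k ^ s))]
  smul_mem' := by
    intro c a ha
    simp only [Set.mem_ofPred_eq] at ha ⊢
    refine (ha.mul_left (c ^ 2)).congr fun k => ?_
    simp only [real_inner_smul_left, sq_abs]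
    ring

/-- The norm of `Ḣˢ(Ω)`. -/
noncomputable def hdotNorm {d : ℕ} {Ω : Opens (Euc d)} (lam : ℕ → ℝ)
    (φ : HilbertBasis ℕ ℝ (L2 Ω)) (s : ℝ) (u : L2 Ω) : ℝ :=
  Real.sqrt (∑' k, lam k ^ s * |inner ℝ u (φ k)| ^ 2)

/-- The eigenfunction `φₖ` as an element of `Ḣˢ(Ω)`. -/
noncomputable def eigH {d : ℕ} {Ω : Opens (Euc d)} (lam : ℕ → ℝ)
    (φ : HilbertBasis ℕ ℝ (L2 Ω)) (s : ℝ) (k : ℕ) : Hdot lam φ s :=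
  ⟨φ k, by
    refine summable_of_ne_finset_zero (s := {k}) fun j hj => ?_
    have hne : k ≠ j := fun h => hj (by simp [h])
    simp [φ.orthonormal.2 hne]⟩

/-- The dual space `Ḣ⁻ˢ(Ω)`: the bounded linear functionals `R : Ḣˢ(Ω) → ℝ` with
`∑ₖ λₖ⁻ˢ |R(φₖ)|² < ∞`, used for `s > 0`. -/
noncomputable def HdotDual {d : ℕ} {Ω : Opens (Euc d)} (lam : ℕ → ℝ)
    (φ : HilbertBasis ℕ ℝ (L2 Ω)) (s : ℝ) : Submodule ℝ (Hdot lam φ s →ₗ[ℝ] ℝ) where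
  carrier := {R | (∃ C : ℝ, ∀ u : Hdot lam φ s, |R u| ≤ C * hdotNorm lam φ s u) ∧
    Summable fun k => lam k ^ (-s) * |R (eigH lam φ s k)| ^ 2}
  zero_mem' := ⟨⟨0, by simp⟩, by simp⟩
  add_mem' := by
    rintro R S ⟨⟨C, hC⟩, hR⟩ ⟨⟨D, hD⟩, hS⟩
    refine ⟨⟨C + D, fun u => ?_⟩, ?_⟩
    · rw [LinearMap.add_apply, add_mul]
      exact (abs_add_le _ _).trans (add_le_add (hC u) (hD u))
    · refine Summable.of_norm_bounded ((hR.norm.mul_left 2).add (hS.norm.mul_left 2))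
        fun k => ?_
      simp only [norm_mul, Real.norm_eq_abs, LinearMap.add_apply, sq_abs, abs_pow]
      have h : (R (eigH lam φ s k) + S (eigH lam φ s k)) ^ 2
          ≤ 2 * (R (eigH lam φ s k)) ^ 2 + 2 * (S (eigH lam φ s k)) ^ 2 := by
        nlinarith [sq_nonneg (R (eigH lam φ s k) - S (eigH lam φ s k))]
      nlinarith [mul_le_mul_of_nonneg_left h (abs_nonneg (lam k ^ (-s)))]
  smul_mem' := by
    rintro c R ⟨⟨C, hC⟩, hR⟩
    refine ⟨⟨|c| * C, fun u => ?_⟩, ?_⟩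
    · rw [LinearMap.smul_apply, smul_eq_mul, abs_mul, mul_assoc]
      exact mul_le_mul_of_nonneg_left (hC u) (abs_nonneg c)
    · refine (hR.mul_left (c ^ 2)).congr fun k => ?_
      simp only [LinearMap.smul_apply, smul_eq_mul, sq_abs]
      ring

/-- The norm of `Ḣ⁻ˢ(Ω)`. -/
noncomputable def hdotDualNorm {d : ℕ} {Ω : Opens (Euc d)} (lam : ℕ → ℝ)
    (φ : HilbertBasis ℕ ℝ (L2 Ω)) (s : ℝ) (R : Hdot lam φ s →ₗ[ℝ] ℝ) : ℝ :=
  Real.sqrt (∑' k, lam k ^ (-s) * |R (eigH lam φ s k)| ^ 2)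

/-- A function `u ∈ L²(Ω)` acting on `Ḣˢ(Ω)` through the inner product of `L²(Ω)`. -/
noncomputable def l2Functional {d : ℕ} {Ω : Opens (Euc d)} (lam : ℕ → ℝ)
    (φ : HilbertBasis ℕ ℝ (L2 Ω)) (s : ℝ) (u : L2 Ω) : Hdot lam φ s →ₗ[ℝ] ℝ :=
  (innerSL ℝ u).toLinearMap ∘ₗ (Hdot lam φ s).subtype

/-- The sequence `U` of functions lies in `Ḣᵗ(Ω)` and converges there, in norm, to the
distribution `T`, which in particular belongs to `Ḣᵗ(Ω)`. For `t ≥ 0` the limit is a function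
`u ∈ Ḣᵗ(Ω)`, and `T` is the distribution given by `u`. For `t < 0` the limit is a functional `R`
in the dual space of `Ḣ^{|t|}(Ω)`, and `T` is the restriction of `R` to `C_c^∞(Ω)`, which is
contained in `Ḣ^{|t|}(Ω)`. -/
def ConvergesInHdot {d : ℕ} {Ω : Opens (Euc d)} (lam : ℕ → ℝ)
    (φ : HilbertBasis ℕ ℝ (L2 Ω)) (t : ℝ) (U : ℕ → L2 Ω) (T : 𝓓'(Ω, ℝ)) : Prop :=
  (0 ≤ t → ∃ u ∈ Hdot lam φ t, (∀ n, U n ∈ Hdot lam φ t) ∧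
    Tendsto (fun n => hdotNorm lam φ t (U n - u)) atTop (𝓝 0) ∧
    ∀ v : 𝓓(Ω, ℝ), T v = ∫ x in (Ω : Set (Euc d)), u x * v x) ∧
  (t < 0 → ∃ R ∈ HdotDual lam φ (-t), (∀ n, l2Functional lam φ (-t) (U n) ∈ HdotDual lam φ (-t)) ∧
    Tendsto (fun n => hdotDualNorm lam φ (-t) (l2Functional lam φ (-t) (U n) - R)) atTop (𝓝 0) ∧
    ∀ v : 𝓓(Ω, ℝ), ∃ hv : testL2 v ∈ Hdot lam φ (-t), T v = R ⟨testL2 v, hv⟩)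

/-- The partial sum `τ ∑_{k < n} (1 + λₖ)^{-1/2} wₖ φₖ` for given values of the weights `wₖ`. -/
noncomputable def partialSum {d : ℕ} {Ω : Opens (Euc d)} (lam : ℕ → ℝ)
    (φ : HilbertBasis ℕ ℝ (L2 Ω)) (τ : ℝ) (w : ℕ → ℝ) (n : ℕ) : L2 Ω :=
  τ • ∑ k ∈ Finset.range n, ((1 + lam k) ^ (-(1 / 2) : ℝ) * w k) • φ k

end Spectral

end StochTest

/-! With `a k` the random coefficients, the expectation of `∑ λₖᵗ aₖ²` is at most `τ² ∑ λₖ^(t-1)`,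
because `(1 + λₖ)⁻¹ ≤ λₖ⁻¹`. This is finite for `t < 1 - d/2` as soon as `λₖ` grows at least like
`k^(2/d)`, and then the random sum is almost surely finite (`ae_summable_of_summable_integral`).
Convergence in `Ḣᵗ` is then the vanishing of the tail of a convergent series (`convergesInHdot`).

The growth of `λₖ` comes from counting in phase space (`card_mul_le`). Extended by zero, an
eigenfunction `φⱼ` with `j ≤ k` has Fourier mass at least `1 - λₖ/(2πr)²` in the ball of radius `r`,
by Plancherel for the gradient. Bessel's inequality against plane waves on `Ω` bounds the total
energy of all `φⱼ` at one frequency by `|Ω|`. Integrating over the ball and taking `r = √λₖ` gives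
`k + 1 ≤ K λₖ^(d/2)`. Only approximation by test functions enters, hence no regularity of the
boundary.

The limit is a distribution because `λₖᵐ ⟨φₖ, v⟩ = ⟨φₖ, (-Δ)ᵐ v⟩`: the series `∑ aₖ φₖ` is `(-Δ)ᵐ`
applied weakly to an `L²` function (`exists_distribution`). -/

namespace StochTest

open scoped FourierTransform LineDeriv SchwartzMap

/-! ### Frequency localisation of test functions -/

/-- Plancherel for the gradient of a Schwartz function. -/
theorem integral_norm_sq_mul_norm_sq_fourier {d : ℕ} (f : 𝓢(Euc d, ℂ)) :
    Integrable (fun ξ => (2 * Real.pi * ‖ξ‖) ^ 2 * ‖𝓕 f ξ‖ ^ 2) ∧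
    ∫ ξ, (2 * Real.pi * ‖ξ‖) ^ 2 * ‖𝓕 f ξ‖ ^ 2
      = ∑ i, ∫ x, ‖fderiv ℝ f x (EuclideanSpace.single i 1)‖ ^ 2 := by
  have key : ∀ (i : Fin d) (ξ : Euc d),
      ‖𝓕 (∂_{(EuclideanSpace.single i 1 : Euc d)} f) ξ‖ ^ 2
        = (2 * Real.pi * ξ i) ^ 2 * ‖𝓕 f ξ‖ ^ 2 := by
    intro i ξ
    have hg : (fun x : Euc d => inner ℝ x (EuclideanSpace.single i (1:ℝ))).HasTemperateGrowth := by
      fun_prop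
    rw [SchwartzMap.fourier_lineDerivOp_eq, smul_apply,
      SchwartzMap.smulLeftCLM_apply_apply hg]
    simp only [norm_smul, norm_mul, EuclideanSpace.inner_single_right]
    simp only [Complex.norm_ofNat, Complex.norm_real, Complex.norm_I, Real.norm_eq_abs,
      mul_pow, sq_abs]
    simp
    ring
  have hint : ∀ i : Fin d, Integrable
      (fun ξ : Euc d => (2 * Real.pi * ξ i) ^ 2 * ‖𝓕 f ξ‖ ^ 2) := by
    intro i
    simp_rw [← key i]
    exact ((𝓕 (∂_{(EuclideanSpace.single i 1 : Euc d)} f)).memLp 2).integrable_norm_pow (by simp)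
  have hsum : ∀ ξ : Euc d, (2 * Real.pi * ‖ξ‖) ^ 2 * ‖𝓕 f ξ‖ ^ 2
      = ∑ i, (2 * Real.pi * ξ i) ^ 2 * ‖𝓕 f ξ‖ ^ 2 := by
    intro ξ
    rw [← Finset.sum_mul, mul_pow, EuclideanSpace.norm_sq_eq, Finset.mul_sum]
    simp [mul_pow]
  simp_rw [hsum]
  refine ⟨integrable_finsetSum _ fun i _ => hint i, ?_⟩
  rw [integral_finsetSum _ fun i _ => hint i]
  refine Finset.sum_congr rfl fun i _ => ?_
  simp_rw [← key i]
  rw [SchwartzMap.integral_norm_sq_fourier]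
  simp_rw [SchwartzMap.lineDerivOp_apply_eq_fderiv]

/-- Low frequencies carry all but `‖∇f‖² / (2πr)²` of the mass of a Schwartz function. -/
theorem sub_le_integral_ball_fourier {d : ℕ} (f : 𝓢(Euc d, ℂ)) {r : ℝ} (hr : 0 < r) :
    (∫ x, ‖f x‖ ^ 2) - (∑ i, ∫ x, ‖fderiv ℝ f x (EuclideanSpace.single i 1)‖ ^ 2)
        / (2 * Real.pi * r) ^ 2
      ≤ ∫ ξ in Metric.ball (0 : Euc d) r, ‖𝓕 f ξ‖ ^ 2 := by
  obtain ⟨hi, he⟩ := integral_norm_sq_mul_norm_sq_fourier f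
  have h2 : Integrable (fun ξ => ‖𝓕 f ξ‖ ^ 2) :=
    ((𝓕 f).memLp 2).integrable_norm_pow (by simp)
  rw [← he, ← SchwartzMap.integral_norm_sq_fourier, sub_le_iff_le_add,
    ← integral_add_compl (measurableSet_ball (x := (0 : Euc d)) (ε := r)) h2]
  gcongr
  rw [← integral_div]
  -- Outside the ball `(2πr)² ≤ (2π‖ξ‖)²`, so the high-frequency mass is controlled by the gradient
  -- energy.
  refine (integral_mono_ae h2.integrableOn (hi.div_const _).integrableOn ?_).trans
    (setIntegral_le_integral (hi.div_const _) (ae_of_all _ fun ξ => by positivity))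
  refine (ae_restrict_iff' measurableSet_ball.compl).2 (ae_of_all _ fun ξ hξ => ?_)
  have hξ' : r ≤ ‖ξ‖ := by simpa using hξ
  have hpi := Real.pi_pos
  have hle : (2 * Real.pi * r) ^ 2 ≤ (2 * Real.pi * ‖ξ‖) ^ 2 := by gcongr
  simp only
  rw [le_div_iff₀ (by positivity)]
  nlinarith [sq_nonneg ‖𝓕 f ξ‖]

/-- A real test function as a complex-valued Schwartz function. -/
noncomputable def testSchwartz {d : ℕ} {Ω : Opens (Euc d)} (v : 𝓓(Ω, ℝ)) : 𝓢(Euc d, ℂ) :=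
  (v.hasCompactSupport.comp_left (g := Complex.ofReal) Complex.ofReal_zero).toSchwartzMap
    (Complex.ofRealCLM.contDiff.comp v.contDiff)

theorem testSchwartz_apply {d : ℕ} {Ω : Opens (Euc d)} (v : 𝓓(Ω, ℝ)) (x : Euc d) :
    testSchwartz v x = (v x : ℂ) := rfl

theorem norm_fderiv_testSchwartz {d : ℕ} {Ω : Opens (Euc d)} (v : 𝓓(Ω, ℝ)) (x e : Euc d) :
    ‖fderiv ℝ (testSchwartz v) x e‖ = |fderiv ℝ v x e| := by
  have hd : DifferentiableAt ℝ v x := v.contDiff.differentiable (by simp) x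
  have : HasFDerivAt (testSchwartz v) (Complex.ofRealCLM.comp (fderiv ℝ v x)) x :=
    Complex.ofRealCLM.hasFDerivAt.comp x hd.hasFDerivAt
  rw [this.fderiv]
  simp

theorem gradient_apply_eq {d : ℕ} (f : Euc d → ℝ) (x : Euc d) (i : Fin d) :
    gradient f x i = fderiv ℝ f x (EuclideanSpace.single i 1) := by
  have : inner ℝ (gradient f x) (EuclideanSpace.single i (1:ℝ))
      = fderiv ℝ f x (EuclideanSpace.single i 1) := by
    simp [gradient, InnerProductSpace.toDual_symm_apply]
  rw [← this, EuclideanSpace.inner_single_right]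
  simp

theorem gradient_eq_zero_of_notMem {d : ℕ} {Ω : Opens (Euc d)} (v : 𝓓(Ω, ℝ)) {x : Euc d}
    (hx : x ∉ Ω) : gradient v x = 0 := by
  have : fderiv ℝ v x = 0 := by
    by_contra h
    exact hx (v.tsupport_subset (support_fderiv_subset ℝ h))
  simp [gradient, this]

theorem test_eq_zero_of_notMem {d : ℕ} {Ω : Opens (Euc d)} (v : 𝓓(Ω, ℝ)) {x : Euc d}
    (hx : x ∉ Ω) : v x = 0 := by
  by_contra h
  exact hx (v.tsupport_subset (subset_tsupport _ h))

theorem continuous_gradient_test {d : ℕ} {Ω : Opens (Euc d)} (v : 𝓓(Ω, ℝ)) :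
    Continuous (gradient v) :=
  (InnerProductSpace.toDual ℝ (Euc d)).symm.continuous.comp
    (v.contDiff.continuous_fderiv (by simp))

theorem hasCompactSupport_gradient_test {d : ℕ} {Ω : Opens (Euc d)} (v : 𝓓(Ω, ℝ)) :
    HasCompactSupport (gradient v) :=
  (v.hasCompactSupport.fderiv ℝ).comp_left (map_zero (InnerProductSpace.toDual ℝ (Euc d)).symm)

theorem memLp_gradient_test {d : ℕ} {Ω : Opens (Euc d)} (v : 𝓓(Ω, ℝ)) :
    MemLp (gradient v) 2 ((volume : Measure (Euc d)).restrict (Ω : Set (Euc d))) :=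
  (continuous_gradient_test v).memLp_of_hasCompactSupport (hasCompactSupport_gradient_test v)

/-- Low frequencies carry all but `‖∇v‖² / (2πr)²` of the mass of a test function. -/
theorem test_sub_le_integral_ball_fourier {d : ℕ} {Ω : Opens (Euc d)} (v : 𝓓(Ω, ℝ)) {r : ℝ}
    (hr : 0 < r) :
    ‖testL2 v‖ ^ 2 - (∫ x in (Ω : Set (Euc d)), ‖gradient v x‖ ^ 2) / (2 * Real.pi * r) ^ 2
      ≤ ∫ ξ in Metric.ball (0 : Euc d) r, ‖𝓕 (testSchwartz v) ξ‖ ^ 2 := by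
  refine le_trans (le_of_eq ?_) (sub_le_integral_ball_fourier (testSchwartz v) hr)
  congr 1
  · rw [← real_inner_self_eq_norm_sq, L2.inner_def]
    have h1 : ∫ x in (Ω : Set (Euc d)), inner ℝ ((testL2 v : L2 Ω) x) ((testL2 v : L2 Ω) x)
        = ∫ x in (Ω : Set (Euc d)), v x ^ 2 := by
      refine integral_congr_ae ?_
      filter_upwards [MemLp.coeFn_toLp (v.continuous.memLp_of_hasCompactSupport (p := 2)
        v.hasCompactSupport (μ := (volume : Measure (Euc d)).restrict (Ω : Set (Euc d))))] with x hx
      rw [testL2, hx]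
      simp [sq]
    rw [h1, setIntegral_eq_integral_of_forall_compl_eq_zero]
    · simp [testSchwartz_apply]
    · intro x hx
      simp [test_eq_zero_of_notMem v hx]
  · rw [setIntegral_eq_integral_of_forall_compl_eq_zero]
    · congr 1
      rw [← integral_finsetSum]
      · refine integral_congr_ae (ae_of_all _ fun x => ?_)
        simp [EuclideanSpace.norm_sq_eq, gradient_apply_eq, norm_fderiv_testSchwartz]
      · intro i _
        have := ((∂_{(EuclideanSpace.single i 1 : Euc d)} (testSchwartz v)).memLp 2
          volume).integrable_norm_pow (by simp)
        simpa [SchwartzMap.lineDerivOp_apply_eq_fderiv] using this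
    · intro x hx
      simp [gradient_eq_zero_of_notMem v hx]

theorem inner_toLp_eq_integral {α : Type*} [MeasurableSpace α] {m : Measure α} {f g : α → ℝ}
    (hf : MemLp f 2 m) (hg : MemLp g 2 m) :
    inner ℝ (hf.toLp f) (hg.toLp g) = ∫ x, f x * g x ∂m := by
  rw [L2.inner_def]
  refine integral_congr_ae ?_
  filter_upwards [hf.coeFn_toLp, hg.coeFn_toLp] with x h1 h2
  rw [h1, h2]
  simp [mul_comm]

theorem memLp_test {d : ℕ} {Ω : Opens (Euc d)} (v : 𝓓(Ω, ℝ)) :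
    MemLp v 2 ((volume : Measure (Euc d)).restrict (Ω : Set (Euc d))) :=
  v.continuous.memLp_of_hasCompactSupport (p := 2) v.hasCompactSupport

theorem inner_testL2 {d : ℕ} {Ω : Opens (Euc d)} (u : L2 Ω) (v : 𝓓(Ω, ℝ)) :
    inner ℝ u (testL2 v) = ∫ x in (Ω : Set (Euc d)), u x * v x := by
  rw [← inner_toLp_eq_integral (Lp.memLp u) (memLp_test v), Lp.toLp_coeFn]
  rfl

/-! ### Energy at a frequency, via plane waves on `Ω` -/

section Waves

variable {d : ℕ} {Ω : Opens (Euc d)}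
  [IsFiniteMeasure ((volume : Measure (Euc d)).restrict (Ω : Set (Euc d)))]

theorem memLp_cosWave (Ω : Opens (Euc d))
    [IsFiniteMeasure ((volume : Measure (Euc d)).restrict (Ω : Set (Euc d)))] (ξ : Euc d) :
    MemLp (fun x : Euc d => Real.cos (2 * Real.pi * inner ℝ x ξ)) 2
      ((volume : Measure (Euc d)).restrict (Ω : Set (Euc d))) :=
  MemLp.of_bound (by fun_prop : Continuous _).aestronglyMeasurable 1
    (ae_of_all _ fun _ => Real.abs_cos_le_one _)

theorem memLp_sinWave (Ω : Opens (Euc d))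
    [IsFiniteMeasure ((volume : Measure (Euc d)).restrict (Ω : Set (Euc d)))] (ξ : Euc d) :
    MemLp (fun x : Euc d => Real.sin (2 * Real.pi * inner ℝ x ξ)) 2
      ((volume : Measure (Euc d)).restrict (Ω : Set (Euc d))) :=
  MemLp.of_bound (by fun_prop : Continuous _).aestronglyMeasurable 1
    (ae_of_all _ fun _ => Real.abs_sin_le_one _)

/-- The energy density at frequency `ξ` of `u`, extended by zero outside `Ω`. -/
noncomputable def freqEnergy (u : L2 Ω) (ξ : Euc d) : ℝ :=
  inner ℝ u ((memLp_cosWave Ω ξ).toLp _) ^ 2 + inner ℝ u ((memLp_sinWave Ω ξ).toLp _) ^ 2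

theorem freqEnergy_nonneg (u : L2 Ω) (ξ : Euc d) : 0 ≤ freqEnergy u ξ := by
  unfold freqEnergy; positivity

theorem norm_sq_cosWave_add_norm_sq_sinWave (ξ : Euc d) :
    ‖(memLp_cosWave Ω ξ).toLp _‖ ^ 2 + ‖(memLp_sinWave Ω ξ).toLp _‖ ^ 2
      = volume.real (Ω : Set (Euc d)) := by
  rw [← real_inner_self_eq_norm_sq, ← real_inner_self_eq_norm_sq, inner_toLp_eq_integral,
    inner_toLp_eq_integral, ← integral_add]
  · simp [← sq]
  · exact (memLp_cosWave Ω ξ).integrable_mul (memLp_cosWave Ω ξ)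
  · exact (memLp_sinWave Ω ξ).integrable_mul (memLp_sinWave Ω ξ)

/-- Bessel's inequality for the plane wave of frequency `ξ`. -/
theorem sum_freqEnergy_le {u : ℕ → L2 Ω} (hu : Orthonormal ℝ u) (s : Finset ℕ) (ξ : Euc d) :
    ∑ k ∈ s, freqEnergy (u k) ξ ≤ volume.real (Ω : Set (Euc d)) := by
  rw [← norm_sq_cosWave_add_norm_sq_sinWave ξ]
  simp only [freqEnergy, Finset.sum_add_distrib]
  have h1 := hu.sum_inner_products_le ((memLp_cosWave Ω ξ).toLp _) (s := s)
  have h2 := hu.sum_inner_products_le ((memLp_sinWave Ω ξ).toLp _) (s := s)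
  simp only [Real.norm_eq_abs, sq_abs] at h1 h2
  exact add_le_add h1 h2

theorem freqEnergy_le (u : L2 Ω) (ξ : Euc d) :
    freqEnergy u ξ ≤ ‖u‖ ^ 2 * volume.real (Ω : Set (Euc d)) := by
  rw [← norm_sq_cosWave_add_norm_sq_sinWave ξ, mul_add, ← mul_pow, ← mul_pow]
  exact add_le_add
    (sq_le_sq' (neg_le_of_abs_le (abs_real_inner_le_norm _ _)) (real_inner_le_norm _ _))
    (sq_le_sq' (neg_le_of_abs_le (abs_real_inner_le_norm _ _)) (real_inner_le_norm _ _))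

/-- Since `v` vanishes off `Ω`, its pairings with the cosine and sine waves are the real part and
minus the imaginary part of the Fourier integral. -/
theorem freqEnergy_testL2 (v : 𝓓(Ω, ℝ)) (ξ : Euc d) :
    freqEnergy (testL2 v) ξ = ‖𝓕 (testSchwartz v) ξ‖ ^ 2 := by
  have hF : 𝓕 (testSchwartz v) ξ
      = ∫ x, Complex.exp (↑(-2 * Real.pi * inner ℝ x ξ) * Complex.I) • (v x : ℂ) := by
    rw [SchwartzMap.fourier_coe, Real.fourier_eq']
    rfl
  have hint : Integrable
      (fun x => Complex.exp (↑(-2 * Real.pi * inner ℝ x ξ) * Complex.I) • (v x : ℂ)) := by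
    have hc : Continuous
        (fun x => Complex.exp (↑(-2 * Real.pi * inner ℝ x ξ) * Complex.I) • (v x : ℂ)) := by
      have := v.continuous
      fun_prop
    refine hc.integrable_of_hasCompactSupport (HasCompactSupport.intro v.hasCompactSupport ?_)
    intro x hx
    simp [image_eq_zero_of_notMem_tsupport hx]
  have hre : (𝓕 (testSchwartz v) ξ).re
      = inner ℝ (testL2 v) ((memLp_cosWave Ω ξ).toLp _) := by
    rw [testL2, inner_toLp_eq_integral, setIntegral_eq_integral_of_forall_compl_eq_zero, hF]
    · have := Complex.reCLM.integral_comp_comm hint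
      rw [Complex.reCLM_apply] at this
      rw [← this]
      refine integral_congr_ae (ae_of_all _ fun x => ?_)
      simp only [Complex.reCLM_apply, smul_eq_mul, Complex.re_mul_ofReal,
        Complex.exp_ofReal_mul_I_re]
      rw [show -2 * Real.pi * inner ℝ x ξ = -(2 * Real.pi * inner ℝ x ξ) by ring, Real.cos_neg,
        mul_comm]
    · intro x hx
      simp [test_eq_zero_of_notMem v hx]
  have him : (𝓕 (testSchwartz v) ξ).im
      = -inner ℝ (testL2 v) ((memLp_sinWave Ω ξ).toLp _) := by
    rw [testL2, inner_toLp_eq_integral, setIntegral_eq_integral_of_forall_compl_eq_zero, hF,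
      ← integral_neg]
    · have := Complex.imCLM.integral_comp_comm hint
      rw [Complex.imCLM_apply] at this
      rw [← this]
      refine integral_congr_ae (ae_of_all _ fun x => ?_)
      simp only [Complex.imCLM_apply, smul_eq_mul, Complex.im_mul_ofReal,
        Complex.exp_ofReal_mul_I_im]
      rw [show -2 * Real.pi * inner ℝ x ξ = -(2 * Real.pi * inner ℝ x ξ) by ring, Real.sin_neg]
      ring
    · intro x hx
      simp [test_eq_zero_of_notMem v hx]
  rw [freqEnergy, Complex.sq_norm, Complex.normSq_apply, hre, him]
  ring

theorem continuous_freqEnergy_testL2 (v : 𝓓(Ω, ℝ)) : Continuous (freqEnergy (testL2 v)) := by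
  have : freqEnergy (testL2 v) = fun ξ => ‖𝓕 (testSchwartz v) ξ‖ ^ 2 :=
    funext (freqEnergy_testL2 v)
  rw [this]
  have := (𝓕 (testSchwartz v)).continuous
  fun_prop

theorem tendsto_freqEnergy {v : ℕ → L2 Ω} {u : L2 Ω} (h : Tendsto v atTop (𝓝 u)) (ξ : Euc d) :
    Tendsto (fun n => freqEnergy (v n) ξ) atTop (𝓝 (freqEnergy u ξ)) :=
  ((h.inner tendsto_const_nhds).pow 2).add ((h.inner tendsto_const_nhds).pow 2)

theorem aestronglyMeasurable_freqEnergy {v : ℕ → 𝓓(Ω, ℝ)} {u : L2 Ω}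
    (h : Tendsto (fun n => testL2 (v n)) atTop (𝓝 u)) (m : Measure (Euc d)) :
    AEStronglyMeasurable (freqEnergy u) m :=
  aestronglyMeasurable_of_tendsto_ae atTop
    (fun n => (continuous_freqEnergy_testL2 (v n)).aestronglyMeasurable)
    (ae_of_all _ fun ξ => tendsto_freqEnergy h ξ)

/-- Dominated convergence: convergent sequences are bounded in `L²`, so `freqEnergy_le` gives a
constant majorant on the ball. -/
theorem tendsto_integral_ball_freqEnergy {v : ℕ → 𝓓(Ω, ℝ)} {u : L2 Ω}
    (h : Tendsto (fun n => testL2 (v n)) atTop (𝓝 u)) (r : ℝ) :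
    Tendsto (fun n => ∫ ξ in Metric.ball (0 : Euc d) r, freqEnergy (testL2 (v n)) ξ) atTop
      (𝓝 (∫ ξ in Metric.ball (0 : Euc d) r, freqEnergy u ξ)) := by
  obtain ⟨M, hM⟩ := h.norm.bddAbove_range
  have : IsFiniteMeasure ((volume : Measure (Euc d)).restrict (Metric.ball 0 r)) :=
    ⟨by simpa using measure_ball_lt_top⟩
  refine tendsto_integral_of_dominated_convergence
    (fun _ => M ^ 2 * volume.real (Ω : Set (Euc d)))
    (fun n => (continuous_freqEnergy_testL2 (v n)).aestronglyMeasurable)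
    (integrable_const _) (fun n => ae_of_all _ fun ξ => ?_)
    (ae_of_all _ fun ξ => tendsto_freqEnergy h ξ)
  rw [Real.norm_eq_abs, abs_of_nonneg (freqEnergy_nonneg _ _)]
  refine (freqEnergy_le _ ξ).trans ?_
  gcongr
  exact hM ⟨n, rfl⟩

end Waves

/-! ### Counting Dirichlet eigenvalues -/

/-- The weak equation cannot be tested with `u` itself. Testing it with the approximants and passing
to the limit identifies `‖g‖²` with `l ‖u‖²`. -/
theorem exists_test_approx {d : ℕ} {Ω : Opens (Euc d)} {l : ℝ} {u : L2 Ω}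
    (hu : IsDirichletEigen Ω l u) :
    ∃ v : ℕ → 𝓓(Ω, ℝ), Tendsto (fun n => testL2 (v n)) atTop (𝓝 u) ∧
      Tendsto (fun n => ∫ x in (Ω : Set (Euc d)), ‖gradient (v n) x‖ ^ 2) atTop
        (𝓝 (l * ‖u‖ ^ 2)) := by
  obtain ⟨g, hg, hweak⟩ := hu
  obtain ⟨v, hv, hgv⟩ := hg.approx
  have h1 : Tendsto (fun n => testL2 (v n)) atTop (𝓝 u) := by
    have := (Lp.tendsto_Lp_iff_tendsto_eLpNorm'' (fun n => (v n : Euc d → ℝ))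
      (fun n => memLp_test (v n)) (u : Euc d → ℝ) (Lp.memLp u)).2 hv
    rwa [Lp.toLp_coeFn] at this
  have h2 := (Lp.tendsto_Lp_iff_tendsto_eLpNorm'' (fun n => gradient (v n))
      (fun n => memLp_gradient_test (v n)) g hg.memLp_grad).2 hgv
  have inner_eq : ∀ (f h : Euc d → Euc d)
      (hf : MemLp f 2 ((volume : Measure (Euc d)).restrict (Ω : Set (Euc d))))
      (hh : MemLp h 2 ((volume : Measure (Euc d)).restrict (Ω : Set (Euc d)))),
      inner ℝ (hf.toLp f) (hh.toLp h) = ∫ x in (Ω : Set (Euc d)), inner ℝ (f x) (h x) := by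
    intro f h hf hh
    rw [L2.inner_def]
    refine integral_congr_ae ?_
    filter_upwards [hf.coeFn_toLp, hh.coeFn_toLp] with x h1 h2
    rw [h1, h2]
  refine ⟨v, h1, ?_⟩
  have h3 : Tendsto (fun n => l * inner ℝ u (testL2 (v n))) atTop (𝓝 (l * ‖u‖ ^ 2)) := by
    rw [← real_inner_self_eq_norm_sq]
    exact (tendsto_const_nhds.inner h1).const_mul l
  have h4 : Tendsto (fun n => l * inner ℝ u (testL2 (v n))) atTop
      (𝓝 (inner ℝ (hg.memLp_grad.toLp g) (hg.memLp_grad.toLp g))) := by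
    refine ((tendsto_const_nhds (x := hg.memLp_grad.toLp g)).inner h2).congr fun n => ?_
    rw [inner_eq, inner_testL2, hweak]
  rw [← tendsto_nhds_unique h4 h3]
  refine (h2.inner h2).congr fun n => ?_
  rw [inner_eq]
  simp

theorem one_sub_le_integral_ball_freqEnergy {d : ℕ} {Ω : Opens (Euc d)}
    [IsFiniteMeasure ((volume : Measure (Euc d)).restrict (Ω : Set (Euc d)))]
    {l : ℝ} {u : L2 Ω} (hu : IsDirichletEigen Ω l u) (hnorm : ‖u‖ = 1) {r : ℝ} (hr : 0 < r) :
    1 - l / (2 * Real.pi * r) ^ 2 ≤ ∫ ξ in Metric.ball (0 : Euc d) r, freqEnergy u ξ := by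
  obtain ⟨v, hv, hgv⟩ := exists_test_approx hu
  have hlim := (hv.norm.pow 2).sub (hgv.div_const ((2 * Real.pi * r) ^ 2))
  rw [hnorm] at hlim
  simp only [one_pow, mul_one] at hlim
  refine le_of_tendsto_of_tendsto' hlim (tendsto_integral_ball_freqEnergy hv r) fun n => ?_
  simp_rw [freqEnergy_testL2]
  exact test_sub_le_integral_ball_fourier (v n) hr

/-- The Berezin–Li–Yau type bound on the number of Dirichlet eigenvalues up to `L`. -/
theorem IsDirichletSpectrum.card_mul_le {d : ℕ} {Ω : Opens (Euc d)}
    [IsFiniteMeasure ((volume : Measure (Euc d)).restrict (Ω : Set (Euc d)))]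
    {lam : ℕ → ℝ} {φ : HilbertBasis ℕ ℝ (L2 Ω)} (h : IsDirichletSpectrum Ω lam φ)
    (k : ℕ) {r : ℝ} (hr : 0 < r) :
    ((k : ℝ) + 1) * (1 - lam k / (2 * Real.pi * r) ^ 2)
      ≤ volume.real (Ω : Set (Euc d)) * (r ^ d * volume.real (Metric.ball (0 : Euc d) 1)) := by
  have : IsFiniteMeasure ((volume : Measure (Euc d)).restrict (Metric.ball 0 r)) :=
    ⟨by simpa using measure_ball_lt_top⟩
  have hpi := Real.pi_pos
  have hint : ∀ j, IntegrableOn (freqEnergy (φ j)) (Metric.ball (0 : Euc d) r) := by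
    intro j
    obtain ⟨v, hv, -⟩ := exists_test_approx (h.eigen j)
    refine Integrable.of_bound (aestronglyMeasurable_freqEnergy hv _)
      (‖φ j‖ ^ 2 * volume.real (Ω : Set (Euc d))) (ae_of_all _ fun ξ => ?_)
    rw [Real.norm_eq_abs, abs_of_nonneg (freqEnergy_nonneg _ _)]
    exact freqEnergy_le _ _
  calc ((k : ℝ) + 1) * (1 - lam k / (2 * Real.pi * r) ^ 2)
      = ∑ j ∈ Finset.range (k + 1), (1 - lam k / (2 * Real.pi * r) ^ 2) := by
        rw [Finset.sum_const, Finset.card_range, nsmul_eq_mul]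
        push_cast
        rfl
    _ ≤ ∑ j ∈ Finset.range (k + 1), ∫ ξ in Metric.ball (0 : Euc d) r, freqEnergy (φ j) ξ := by
        refine Finset.sum_le_sum fun j hj => le_trans ?_
          (one_sub_le_integral_ball_freqEnergy (h.eigen j) (φ.orthonormal.1 j) hr)
        -- Each `lam j` with `j ≤ k` is replaced by the largest one, `lam k`.
        have := h.mono (Nat.lt_succ_iff.1 (Finset.mem_range.1 hj))
        gcongr
    _ = ∫ ξ in Metric.ball (0 : Euc d) r, ∑ j ∈ Finset.range (k + 1), freqEnergy (φ j) ξ :=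
        (integral_finsetSum _ fun j _ => hint j).symm
    _ ≤ ∫ ξ in Metric.ball (0 : Euc d) r, volume.real (Ω : Set (Euc d)) :=
        integral_mono (integrable_finsetSum _ fun j _ => hint j) (integrable_const _)
          fun ξ => sum_freqEnergy_le φ.orthonormal _ ξ
    _ = _ := by
        have := Measure.addHaar_ball_of_pos (volume : Measure (Euc d)) 0 hr
        rw [finrank_euclideanSpace_fin] at this
        rw [setIntegral_const, smul_eq_mul, mul_comm, measureReal_def (s := Metric.ball 0 r), this,
          ENNReal.toReal_mul, ENNReal.toReal_ofReal (by positivity), ← measureReal_def]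

/-! ### Positivity, growth and summability of the eigenvalues -/

section Eigenvalues

variable {d : ℕ} {Ω : Opens (Euc d)}
  [IsFiniteMeasure ((volume : Measure (Euc d)).restrict (Ω : Set (Euc d)))]
  {lam : ℕ → ℝ} {φ : HilbertBasis ℕ ℝ (L2 Ω)}

/-- A nonpositive eigenvalue would lose no mass at any radius, so `card_mul_le` would give `1 ≤ C
r^d` for all `r > 0`, which fails as `r → 0` because `d ≥ 1`. -/
theorem IsDirichletSpectrum.lam_pos (h : IsDirichletSpectrum Ω lam φ) (hd : 1 ≤ d) (k : ℕ) :
    0 < lam k := by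
  by_contra! hk
  set C := volume.real (Ω : Set (Euc d)) * volume.real (Metric.ball (0 : Euc d) 1) with hC
  have hlim : Tendsto (fun r : ℝ => C * r ^ d) (𝓝[>] 0) (𝓝 0) := by
    have : Tendsto (fun r : ℝ => C * r ^ d) (𝓝 0) (𝓝 (C * 0 ^ d)) :=
      (Continuous.tendsto (by fun_prop) 0)
    rw [zero_pow (by omega), mul_zero] at this
    exact this.mono_left nhdsWithin_le_nhds
  have hle : ∀ᶠ r : ℝ in 𝓝[>] 0, (1 : ℝ) ≤ C * r ^ d := by
    filter_upwards [self_mem_nhdsWithin] with r hr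
    have h1 := h.card_mul_le k hr
    have h2 : lam k / (2 * Real.pi * r) ^ 2 ≤ 0 := div_nonpos_of_nonpos_of_nonneg hk (sq_nonneg _)
    have h3 : (0 : ℝ) ≤ k := Nat.cast_nonneg k
    rw [hC]
    nlinarith
  exact absurd (ge_of_tendsto hlim hle) (by norm_num)

theorem IsDirichletSpectrum.exists_le_mul_rpow (h : IsDirichletSpectrum Ω lam φ) (hd : 1 ≤ d) :
    ∃ K : ℝ, 0 < K ∧ ∀ k : ℕ, (k : ℝ) + 1 ≤ K * lam k ^ ((d : ℝ) / 2) := by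
  set C := volume.real (Ω : Set (Euc d)) * volume.real (Metric.ball (0 : Euc d) 1) with hC
  have hC0 : 0 ≤ C := by positivity
  -- With `r = √λₖ` the lost mass is `1/(2π)² ≤ 1/2`, whence the factor `2`; the `+ 1` only makes
  -- `K` positive.
  refine ⟨2 * C + 1, by positivity, fun k => ?_⟩
  have hl := h.lam_pos hd k
  have h1 := h.card_mul_le k (Real.sqrt_pos.2 hl)
  have h2 : lam k / (2 * Real.pi * √(lam k)) ^ 2 ≤ 1 / 2 := by
    rw [mul_pow, Real.sq_sqrt hl.le, div_le_iff₀ (by positivity)]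
    have : (9 : ℝ) ≤ Real.pi ^ 2 := by nlinarith [Real.pi_gt_three]
    nlinarith
  have h3 : √(lam k) ^ d = lam k ^ ((d : ℝ) / 2) := by
    rw [Real.sqrt_eq_rpow, ← Real.rpow_natCast, ← Real.rpow_mul hl.le]
    congr 1
    ring
  have h4 : (0 : ℝ) ≤ lam k ^ ((d : ℝ) / 2) := by positivity
  rw [h3] at h1
  have h5 : ((k : ℝ) + 1) * (1 / 2)
      ≤ ((k : ℝ) + 1) * (1 - lam k / (2 * Real.pi * √(lam k)) ^ 2) := by
    gcongr
    linarith
  have h6 : ((k : ℝ) + 1) * (1 / 2) ≤ C * lam k ^ ((d : ℝ) / 2) := by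
    refine (h5.trans h1).trans (le_of_eq ?_)
    rw [hC]; ring
  linarith

theorem IsDirichletSpectrum.summable_rpow (h : IsDirichletSpectrum Ω lam φ) (hd : 1 ≤ d) {p : ℝ}
    (hp : p < -((d : ℝ) / 2)) : Summable fun k => lam k ^ p := by
  obtain ⟨K, hK, hle⟩ := h.exists_le_mul_rpow hd
  have hd0 : (0 : ℝ) < d := by exact_mod_cast hd
  -- Chosen so that `(d/2) q = -p`: raising the growth bound to the power `q` compares `λₖᵖ` with
  -- `(k + 1)^(-q)`, and `q > 1`.
  set q : ℝ := -(2 * p / d) with hq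
  have hq1 : 1 < q := by
    rw [hq, ← neg_div, lt_div_iff₀ hd0]; linarith
  have hs := ((Real.summable_one_div_nat_add_rpow 1 q).2 hq1).mul_left (K ^ q)
  refine Summable.of_nonneg_of_le (fun k => Real.rpow_nonneg (h.lam_pos hd k).le _) (fun k => ?_) hs
  have hl := h.lam_pos hd k
  have hk : (0 : ℝ) < k + 1 := by positivity
  rw [abs_of_pos hk, mul_one_div, le_div_iff₀ (by positivity)]
  have h1 : ((k : ℝ) + 1) ^ q ≤ (K * lam k ^ ((d : ℝ) / 2)) ^ q :=
    Real.rpow_le_rpow hk.le (hle k) (by linarith)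
  rw [Real.mul_rpow hK.le (by positivity), ← Real.rpow_mul hl.le,
    show (d : ℝ) / 2 * q = -p by rw [hq]; field_simp, Real.rpow_neg hl.le] at h1
  have h2 : 0 < lam k ^ p := by positivity
  calc lam k ^ p * ((k : ℝ) + 1) ^ q ≤ lam k ^ p * (K ^ q * (lam k ^ p)⁻¹) := by gcongr
    _ = K ^ q := by field_simp

end Eigenvalues

theorem rpow_le_rpow_sub_mul {x₀ x s t : ℝ} (h0 : 0 < x₀) (hx : x₀ ≤ x) (hst : s ≤ t) :
    x ^ s ≤ x₀ ^ (s - t) * x ^ t := by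
  have hx0 : 0 < x := h0.trans_le hx
  calc x ^ s = x ^ (s - t) * x ^ t := by rw [← Real.rpow_add hx0]; congr 1; ring
    _ ≤ x₀ ^ (s - t) * x ^ t := by
      gcongr ?_ * _
      exact Real.rpow_le_rpow_of_nonpos h0 hx (by linarith)

/-- All eigenvalues stay above `lam 0 > 0`, so lowering the exponent costs only a constant factor.
-/
theorem summable_rpow_mul_of_le {lam : ℕ → ℝ} (hmono : Monotone lam) (hpos : ∀ k, 0 < lam k)
    {a : ℕ → ℝ} (ha : ∀ k, 0 ≤ a k) {s t : ℝ} (hst : s ≤ t)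
    (h : Summable fun k => lam k ^ t * a k) : Summable fun k => lam k ^ s * a k := by
  refine Summable.of_nonneg_of_le (fun k => ?_) (fun k => ?_) (h.mul_left (lam 0 ^ (s - t)))
  · exact mul_nonneg (Real.rpow_nonneg (hpos k).le _) (ha k)
  · rw [← mul_assoc]
    exact mul_le_mul_of_nonneg_right
      (rpow_le_rpow_sub_mul (hpos 0) (hmono (Nat.zero_le k)) hst) (ha k)

/-! ### Powers of `-Δ` on test functions, and distributions -/

/-- The partial derivative `∂ᵢ` on test functions. -/
noncomputable def partialDeriv {d : ℕ} (Ω : Opens (Euc d)) (i : Fin d) : 𝓓(Ω, ℝ) →L[ℝ] 𝓓(Ω, ℝ) :=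
  TestFunction.lineDerivCLM ℝ (EuclideanSpace.single i 1)

/-- The operator `-Δ` on test functions. -/
noncomputable def negLaplacian {d : ℕ} (Ω : Opens (Euc d)) : 𝓓(Ω, ℝ) →L[ℝ] 𝓓(Ω, ℝ) :=
  -∑ i : Fin d, (partialDeriv Ω i).comp (partialDeriv Ω i)

theorem partialDeriv_apply {d : ℕ} {Ω : Opens (Euc d)} (i : Fin d) (v : 𝓓(Ω, ℝ)) (x : Euc d) :
    partialDeriv Ω i v x = fderiv ℝ v x (EuclideanSpace.single i 1) := by
  rw [partialDeriv, TestFunction.lineDerivCLM_apply_of_le (by simp)]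
  exact (v.contDiff.differentiable (by simp) x).lineDeriv_eq_fderiv

theorem negLaplacian_apply {d : ℕ} {Ω : Opens (Euc d)} (v : 𝓓(Ω, ℝ)) (x : Euc d) :
    negLaplacian Ω v x = -∑ i : Fin d, partialDeriv Ω i (partialDeriv Ω i v) x := by
  let ev : 𝓓(Ω, ℝ) →+ ℝ := ⟨⟨fun f => f x, rfl⟩, fun _ _ => rfl⟩
  have h : negLaplacian Ω v = -∑ i : Fin d, partialDeriv Ω i (partialDeriv Ω i v) := by
    simp [negLaplacian]
  rw [h]
  exact (map_neg ev _).trans (congrArg _ (map_sum ev _ _))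

/-- The weak equation yields `∫ g · ∇v`; the definition of the weak gradient, with `∂ᵢ v` as test
function, moves the remaining derivative onto `v`. -/
theorem IsDirichletEigen.mul_inner_testL2 {d : ℕ} {Ω : Opens (Euc d)} {l : ℝ} {u : L2 Ω}
    (hu : IsDirichletEigen Ω l u) (v : 𝓓(Ω, ℝ)) :
    l * inner ℝ u (testL2 v) = inner ℝ u (testL2 (negLaplacian Ω v)) := by
  obtain ⟨g, hg, hweak⟩ := hu
  have hgi : ∀ i, MemLp (fun x => g x i) 2
      ((volume : Measure (Euc d)).restrict (Ω : Set (Euc d))) := fun i =>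
    (EuclideanSpace.proj (𝕜 := ℝ) i).comp_memLp' hg.memLp_grad
  rw [inner_testL2, inner_testL2, ← hweak]
  have h1 : ∀ x, inner ℝ (g x) (gradient v x) = ∑ i, g x i * partialDeriv Ω i v x := by
    intro x
    rw [PiLp.inner_apply]
    refine Finset.sum_congr rfl fun i _ => ?_
    rw [gradient_apply_eq, partialDeriv_apply]
    simp [mul_comm]
  have h2 : ∀ x, u x * negLaplacian Ω v x
      = -∑ i, u x * fderiv ℝ (partialDeriv Ω i v) x (EuclideanSpace.single i 1) := by
    intro x
    simp_rw [negLaplacian_apply, mul_neg, Finset.mul_sum, ← partialDeriv_apply]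
  simp_rw [h1, h2]
  rw [integral_finsetSum, integral_neg, integral_finsetSum, ← Finset.sum_neg_distrib]
  · refine Finset.sum_congr rfl fun i _ => ?_
    rw [hg.weak_grad, neg_neg]
  · intro i _
    simp_rw [← partialDeriv_apply]
    exact hg.memLp.integrable_mul (memLp_test _)
  · intro i _
    exact (hgi i).integrable_mul (memLp_test _)

section Test

variable {d : ℕ} {Ω : Opens (Euc d)} {lam : ℕ → ℝ} {φ : HilbertBasis ℕ ℝ (L2 Ω)}

theorem IsDirichletSpectrum.pow_mul_inner_testL2 (h : IsDirichletSpectrum Ω lam φ) (k m : ℕ)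
    (v : 𝓓(Ω, ℝ)) :
    lam k ^ m * inner ℝ (φ k) (testL2 v) = inner ℝ (φ k) (testL2 ((negLaplacian Ω ^ m) v)) := by
  induction m generalizing v with
  | zero => simp
  | succ m ih =>
    rw [pow_succ, pow_succ, mul_assoc, (h.eigen k).mul_inner_testL2, ih]
    rfl

theorem IsDirichletSpectrum.testL2_mem_Hdot (h : IsDirichletSpectrum Ω lam φ)
    (hpos : ∀ k, 0 < lam k) (s : ℝ) (v : 𝓓(Ω, ℝ)) : testL2 v ∈ Hdot lam φ s := by
  change Summable fun k => lam k ^ s * |inner ℝ (testL2 v) (φ k)| ^ 2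
  -- The exponent is raised to `2m ≥ s`, where the weighted terms are the squared coefficients of
  -- `(-Δ)ᵐ v`, an `L²` function.
  obtain ⟨m, hm⟩ := exists_nat_ge s
  refine summable_rpow_mul_of_le h.mono hpos (fun k => sq_nonneg _)
    (t := ((2 * m : ℕ) : ℝ)) (by push_cast; linarith [(Nat.cast_nonneg m : (0 : ℝ) ≤ m)]) ?_
  refine (φ.summable_inner_mul_inner (testL2 ((negLaplacian Ω ^ m) v))
    (testL2 ((negLaplacian Ω ^ m) v))).congr fun k => ?_
  rw [real_inner_comm, ← h.pow_mul_inner_testL2, Real.rpow_natCast, sq_abs, real_inner_comm]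
  ring

theorem exists_inner_eq (φ : HilbertBasis ℕ ℝ (L2 Ω)) {c : ℕ → ℝ}
    (hc : Summable fun k => c k ^ 2) : ∃ b : L2 Ω, ∀ k, inner ℝ (φ k) b = c k := by
  have hm : Memℓp c 2 := by
    refine memℓp_gen ?_
    simpa using hc
  refine ⟨φ.repr.symm ⟨c, hm⟩, fun k => ?_⟩
  rw [← φ.repr_apply_apply, LinearIsometryEquiv.apply_symm_apply]

/-- A series `∑ aₖ φₖ` with coefficients of at most polynomial growth, measured by the eigenvalues,
defines a distribution. -/
theorem IsDirichletSpectrum.exists_distribution (h : IsDirichletSpectrum Ω lam φ)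
    (hpos : ∀ k, 0 < lam k) {a : ℕ → ℝ} (m : ℕ)
    (ha : Summable fun k => lam k ^ (-(2 * m : ℝ)) * a k ^ 2) :
    ∃ T : 𝓓'(Ω, ℝ), ∀ v : 𝓓(Ω, ℝ), HasSum (fun k => a k * inner ℝ (φ k) (testL2 v)) (T v) := by
  -- `b = ∑ λₖ⁻ᵐ aₖ φₖ` lies in `L²`, and `T v = ⟨b, (-Δ)ᵐ v⟩` is continuous as a composition of
  -- continuous maps.
  obtain ⟨b, hb⟩ := exists_inner_eq φ (c := fun k => (lam k ^ m)⁻¹ * a k) (by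
    refine ha.congr fun k => ?_
    rw [Real.rpow_neg (hpos k).le, show (2 * m : ℝ) = ((2 * m : ℕ) : ℝ) by push_cast; rfl,
      Real.rpow_natCast, mul_pow, inv_pow]
    ring_nf)
  have hloc : LocallyIntegrableOn (b : Euc d → ℝ) Ω
      ((volume : Measure (Euc d)).restrict (Ω : Set (Euc d))) :=
    (Lp.memLp b).locallyIntegrable (by norm_num) |>.locallyIntegrableOn _
  let T : 𝓓(Ω, ℝ) →L[ℝ] ℝ := (TestFunction.integralAgainstBilinCLM (ContinuousLinearMap.mul ℝ ℝ)
    ((volume : Measure (Euc d)).restrict (Ω : Set (Euc d))) b).comp (negLaplacian Ω ^ m)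
  refine ⟨T, fun v => ?_⟩
  have hT : T v = inner ℝ b (testL2 ((negLaplacian Ω ^ m) v)) := by
    rw [inner_testL2, ContinuousLinearMap.comp_apply,
      TestFunction.integralAgainstBilinCLM_eq_integral hloc]
    simp [mul_comm]
  change HasSum _ (T v)
  rw [hT]
  refine (φ.hasSum_inner_mul_inner b (testL2 ((negLaplacian Ω ^ m) v))).congr_fun fun k => ?_
  rw [← h.pow_mul_inner_testL2, real_inner_comm (φ k) b, hb]
  have := (pow_pos (hpos k) m).ne'
  field_simp

end Test

/-! ### Convergence of series in `Ḣᵗ` -/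

theorem tendsto_tsum_ite_lt {f : ℕ → ℝ} (hf : Summable f) :
    Tendsto (fun n => ∑' k, if k < n then 0 else f k) atTop (𝓝 0) := by
  have h : ∀ n, ∑' k, (if k < n then 0 else f k) = ∑' k, f k - ∑ k ∈ Finset.range n, f k := by
    intro n
    have h1 : HasSum (fun k => if k < n then f k else 0) (∑ k ∈ Finset.range n, f k) := by
      rw [Finset.sum_congr rfl (g := fun k => if k < n then f k else 0)
        fun k hk => (if_pos (Finset.mem_range.1 hk)).symm]
      exact hasSum_sum_of_ne_finset_zero fun k hk => if_neg fun h => hk (Finset.mem_range.2 h)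
    rw [← (hf.hasSum.sub h1).tsum_eq]
    congr 1
    ext k
    split_ifs <;> simp
  simp_rw [h]
  simpa using (tendsto_const_nhds (x := ∑' k, f k)).sub hf.hasSum.tendsto_sum_nat

section Convergence

variable {d : ℕ} {Ω : Opens (Euc d)} {lam : ℕ → ℝ} {φ : HilbertBasis ℕ ℝ (L2 Ω)}

theorem inner_sum_smul (φ : HilbertBasis ℕ ℝ (L2 Ω)) (a : ℕ → ℝ) (n k : ℕ) :
    inner ℝ (∑ j ∈ Finset.range n, a j • φ j) (φ k) = if k < n then a k else 0 := by
  simp [sum_inner, real_inner_smul_left, orthonormal_iff_ite.1 φ.orthonormal]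

theorem sum_smul_mem_Hdot (s : ℝ) (a : ℕ → ℝ) (n : ℕ) :
    ∑ j ∈ Finset.range n, a j • φ j ∈ Hdot lam φ s :=
  Submodule.sum_mem _ fun j _ => Submodule.smul_mem _ _ (eigH lam φ s j).2

theorem summable_Hdot {s : ℝ} (x : Hdot lam φ s) :
    Summable fun k => lam k ^ s * inner ℝ (φ k) (x : L2 Ω) ^ 2 := by
  refine Summable.congr x.2 fun k => ?_
  rw [sq_abs, real_inner_comm]

/-- Splits the weight into `l^(-s)` and `l^s` for the Cauchy–Schwarz pairing of `Ḣ⁻ˢ` with `Ḣˢ`. -/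
theorem mul_sq_eq {l s a b : ℝ} (hl : 0 < l) :
    (a * b) ^ 2 = (l ^ (-s) * a ^ 2) * (l ^ s * b ^ 2) := by
  rw [Real.rpow_neg hl.le]
  have := (Real.rpow_pos_of_pos hl s).ne'
  field_simp

theorem summable_mul_inner (hpos : ∀ k, 0 < lam k) {s : ℝ} {a : ℕ → ℝ}
    (ha : Summable fun k => lam k ^ (-s) * a k ^ 2) (x : Hdot lam φ s) :
    Summable fun k => a k * inner ℝ (φ k) (x : L2 Ω) := by
  refine Summable.of_norm_bounded (ha.add (summable_Hdot x)) fun k => ?_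
  have h1 : 0 ≤ lam k ^ (-s) * a k ^ 2 := mul_nonneg (Real.rpow_nonneg (hpos k).le _) (sq_nonneg _)
  have h2 : 0 ≤ lam k ^ s * inner ℝ (φ k) (x : L2 Ω) ^ 2 :=
    mul_nonneg (Real.rpow_nonneg (hpos k).le _) (sq_nonneg _)
  rw [Real.norm_eq_abs]
  refine abs_le_of_sq_le_sq ?_ (add_nonneg h1 h2)
  rw [mul_sq_eq (hpos k) (s := s)]
  nlinarith

theorem eq_of_hasSum_mul_inner_eigH {s : ℝ} {b : ℕ → ℝ} {k : ℕ} {z : ℝ}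
    (hz : HasSum (fun j => b j * inner ℝ (φ j) (eigH lam φ s k : L2 Ω)) z) : z = b k := by
  refine hz.unique ?_
  convert hasSum_single k ?_ using 1
  · simp [eigH, φ.orthonormal.1 k]
  · intro j hj
    simp [eigH, φ.orthonormal.2 hj]

/-- Square-summable coefficients in the weighted sense define an element of `Ḣ⁻ˢ(Ω)`. -/
theorem exists_mem_HdotDual (hpos : ∀ k, 0 < lam k) {s : ℝ} {a : ℕ → ℝ}
    (ha : Summable fun k => lam k ^ (-s) * a k ^ 2) :
    ∃ R ∈ HdotDual lam φ s,
      ∀ x : Hdot lam φ s, HasSum (fun k => a k * inner ℝ (φ k) (x : L2 Ω)) (R x) := by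
  have hsum := fun x : Hdot lam φ s => summable_mul_inner hpos ha x
  let R : Hdot lam φ s →ₗ[ℝ] ℝ :=
    { toFun := fun x => ∑' k, a k * inner ℝ (φ k) (x : L2 Ω)
      map_add' := fun x y => by
        rw [← (hsum x).tsum_add (hsum y)]
        simp [inner_add_right, mul_add]
      map_smul' := fun c x => by
        rw [RingHom.id_apply, smul_eq_mul, ← tsum_mul_left]
        refine tsum_congr fun k => ?_
        rw [Submodule.coe_smul, real_inner_smul_right]
        ring }
  have hR : ∀ x : Hdot lam φ s, HasSum (fun k => a k * inner ℝ (φ k) (x : L2 Ω)) (R x) :=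
    fun x => (hsum x).hasSum
  have hReig : ∀ k, R (eigH lam φ s k) = a k := fun k => eq_of_hasSum_mul_inner_eigH (hR _)
  refine ⟨R, ⟨⟨√(∑' k, lam k ^ (-s) * a k ^ 2), fun x => ?_⟩, ?_⟩, hR⟩
  · have hx := summable_Hdot x
    have hnorm : hdotNorm lam φ s x = √(∑' k, lam k ^ s * inner ℝ (φ k) (x : L2 Ω) ^ 2) := by
      simp only [hdotNorm, sq_abs, real_inner_comm]
    rw [hnorm, ← Real.sqrt_mul' _ (tsum_nonneg fun k =>
      mul_nonneg (Real.rpow_nonneg (hpos k).le _) (sq_nonneg _)), ← Real.sqrt_sq_eq_abs]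
    -- Cauchy–Schwarz for the partial sums, then the limit.
    refine Real.sqrt_le_sqrt (le_of_tendsto_of_tendsto' ((hR x).tendsto_sum_nat.pow 2)
      (ha.hasSum.tendsto_sum_nat.mul hx.hasSum.tendsto_sum_nat) fun n => ?_)
    exact Finset.sum_sq_le_sum_mul_sum_of_sq_le_mul _
      (fun k _ => mul_nonneg (Real.rpow_nonneg (hpos k).le _) (sq_nonneg _))
      (fun k _ => mul_nonneg (Real.rpow_nonneg (hpos k).le _) (sq_nonneg _))
      (fun k _ => (mul_sq_eq (hpos k)).le)
  · simpa [hReig] using ha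

/-- If the coefficients are square summable with weights `λₖᵗ`, then the series `∑ aₖ φₖ` converges
in `Ḣᵗ(Ω)` to the distribution which it defines. -/
theorem IsDirichletSpectrum.convergesInHdot (h : IsDirichletSpectrum Ω lam φ)
    (hpos : ∀ k, 0 < lam k) {a : ℕ → ℝ} {t : ℝ} (ha : Summable fun k => lam k ^ t * a k ^ 2)
    {T : 𝓓'(Ω, ℝ)}
    (hT : ∀ v : 𝓓(Ω, ℝ), HasSum (fun k => a k * inner ℝ (φ k) (testL2 v)) (T v)) :
    ConvergesInHdot lam φ t (fun n => ∑ k ∈ Finset.range n, a k • φ k) T := by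
  have htail : Tendsto (fun n => √(∑' k, if k < n then 0 else lam k ^ t * a k ^ 2)) atTop (𝓝 0) := by
    simpa using (tendsto_tsum_ite_lt ha).sqrt
  refine ⟨fun ht => ?_, fun ht => ?_⟩
  -- For `t ≥ 0` the exponent can be lowered to `0`, so the coefficients are square summable and the
  -- limit exists in `L²`.
  · obtain ⟨u, hu⟩ := exists_inner_eq φ (c := a) (by
      simpa using summable_rpow_mul_of_le h.mono hpos (fun k => sq_nonneg (a k)) ht ha)
    refine ⟨u, ?_, fun n => sum_smul_mem_Hdot t a n, ?_, fun v => ?_⟩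
    · refine Summable.congr ha fun k => ?_
      rw [sq_abs, real_inner_comm, hu]
    · refine htail.congr fun n => ?_
      rw [hdotNorm]
      congr 2
      ext k
      rw [inner_sub_left, inner_sum_smul, real_inner_comm, hu]
      split_ifs <;> simp
    · rw [← inner_testL2]
      refine (hT v).unique ((φ.hasSum_inner_mul_inner u (testL2 v)).congr_fun fun k => ?_)
      rw [real_inner_comm (φ k) u, hu]
  · obtain ⟨R, hR, hRsum⟩ := exists_mem_HdotDual (φ := φ) hpos (s := -t) (a := a) (by
      simpa using ha)
    have hUsum : ∀ (n : ℕ) (x : Hdot lam φ (-t)),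
        HasSum (fun k => (if k < n then a k else 0) * inner ℝ (φ k) (x : L2 Ω))
          (l2Functional lam φ (-t) (∑ k ∈ Finset.range n, a k • φ k) x) := by
      intro n x
      refine (φ.hasSum_inner_mul_inner (∑ k ∈ Finset.range n, a k • φ k) (x : L2 Ω)).congr_fun
        fun k => ?_
      rw [inner_sum_smul]
    refine ⟨R, hR, fun n => ?_, ?_, fun v => ?_⟩
    -- A partial sum acts as the functional with truncated coefficients, whose weighted sum is
    -- finite.
    · obtain ⟨S, hS, hSsum⟩ := exists_mem_HdotDual (φ := φ) hpos (s := -t)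
        (a := fun k => if k < n then a k else 0)
        (summable_of_ne_finset_zero (s := Finset.range n) fun k hk => by
          simp [show ¬ k < n from fun h => hk (Finset.mem_range.2 h)])
      have : l2Functional lam φ (-t) (∑ k ∈ Finset.range n, a k • φ k) = S :=
        LinearMap.ext fun x => (hUsum n x).unique (hSsum x)
      rwa [this]
    · refine htail.congr fun n => ?_
      rw [hdotDualNorm]
      congr 2
      ext k
      rw [LinearMap.sub_apply, eq_of_hasSum_mul_inner_eigH (hUsum n _),
        eq_of_hasSum_mul_inner_eigH (hRsum _), neg_neg]
      split_ifs <;> simp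
    · exact ⟨h.testL2_mem_Hdot hpos (-t) v, (hT v).unique (hRsum ⟨testL2 v, _⟩)⟩

end Convergence

/-! ### Almost sure summability and the conclusion -/

/-- By Tonelli the sum, taken in `[0, ∞]`, has finite integral and is therefore finite almost
everywhere. -/
theorem ae_summable_of_summable_integral {Ξ : Type*} [MeasurableSpace Ξ] {μ : Measure Ξ}
    {f : ℕ → Ξ → ℝ} (hf : ∀ k, Integrable (f k) μ) (h0 : ∀ k ξ, 0 ≤ f k ξ)
    (hs : Summable fun k => ∫ ξ, f k ξ ∂μ) : ∀ᵐ ξ ∂μ, Summable fun k => f k ξ := by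
  have hlt : ∫⁻ ξ, ∑' k, ENNReal.ofReal (f k ξ) ∂μ ≠ ⊤ := by
    rw [lintegral_tsum fun k => (hf k).aestronglyMeasurable.aemeasurable.ennreal_ofReal]
    simp_rw [← ofReal_integral_eq_lintegral_ofReal (hf _) (ae_of_all _ (h0 _))]
    exact hs.tsum_ofReal_ne_top
  filter_upwards [ae_lt_top' (AEMeasurable.tsum fun k =>
    (hf k).aestronglyMeasurable.aemeasurable.ennreal_ofReal) hlt] with ξ hξ
  refine (ENNReal.summable_toReal hξ.ne).congr fun k => ?_
  rw [ENNReal.toReal_ofReal (h0 k ξ)]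

end StochTest

theorem lemma3p1 {d : ℕ} (hd : 1 ≤ d) (Ω : Opens (StochTest.Euc d))
    (hΩ : Bornology.IsBounded (Ω : Set (StochTest.Euc d)))
    (lam : ℕ → ℝ) (φ : HilbertBasis ℕ ℝ (StochTest.L2 Ω))
    (hspec : StochTest.IsDirichletSpectrum Ω lam φ)
    {Ξ : Type*} [MeasurableSpace Ξ] (μ : Measure Ξ) [IsProbabilityMeasure μ]
    (w : ℕ → Ξ → ℝ) (hw_memLp : ∀ k, MemLp (w k) 2 μ) (hw_indep : iIndepFun w μ)
    (hw_mean : ∀ k, ∫ ξ, w k ξ ∂μ = 0) (hw_var : ∀ k, variance (w k) μ = 1)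
    (τ : ℝ) (hτ : 0 < τ) :
    ∃ Φ : Ξ → 𝓓'(Ω, ℝ),
      (∀ v : 𝓓(Ω, ℝ), AEMeasurable (fun ξ => Φ ξ v) μ) ∧
      (∀ᵐ ξ ∂μ, ∀ ε : ℝ, 0 < ε →
        StochTest.ConvergesInHdot lam φ (1 - (d : ℝ) / 2 - ε)
          (StochTest.partialSum lam φ τ (fun k => w k ξ)) (Φ ξ)) ∧
      (2 ≤ d → ∀ ε : ℝ, 0 < ε → 1 - (d : ℝ) / 2 - ε < 0) := by
  classical
  have : IsFiniteMeasure ((volume : Measure (StochTest.Euc d)).restrict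
      (Ω : Set (StochTest.Euc d))) := ⟨by simpa using hΩ.measure_lt_top⟩
  have hpos := hspec.lam_pos hd
  let a (k : ℕ) (ξ : Ξ) : ℝ := τ * ((1 + lam k) ^ (-(1 / 2) : ℝ) * w k ξ)
  have hint : ∀ k, ∫ ξ, w k ξ ^ 2 ∂μ = 1 := fun k => by
    rw [← hw_var k, variance_of_integral_eq_zero (hw_memLp k).1.aemeasurable (hw_mean k)]
  have ha_sq : ∀ k ξ, a k ξ ^ 2 = (τ ^ 2 * (1 + lam k)⁻¹) * w k ξ ^ 2 := fun k ξ => by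
    have hl : 0 < 1 + lam k := by linarith [hpos k]
    have : ((1 + lam k) ^ (-(1 / 2) : ℝ)) ^ 2 = (1 + lam k)⁻¹ := by
      rw [← Real.rpow_natCast, ← Real.rpow_mul hl.le, ← Real.rpow_neg_one]
      norm_num
    simp only [a, mul_pow, this]
    ring
  have hsum : ∀ t : ℝ, t < 1 - (d : ℝ) / 2 →
      ∀ᵐ ξ ∂μ, Summable fun k => lam k ^ t * a k ξ ^ 2 := by
    intro t ht
    refine StochTest.ae_summable_of_summable_integral (fun k => ?_) (fun k ξ => ?_) ?_
    · simp_rw [ha_sq]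
      exact ((hw_memLp k).integrable_sq.const_mul _).const_mul _
    · exact mul_nonneg (Real.rpow_nonneg (hpos k).le _) (sq_nonneg _)
    · simp_rw [ha_sq, integral_const_mul, hint, mul_one]
      refine Summable.of_nonneg_of_le (fun k => ?_) (fun k => ?_)
        ((hspec.summable_rpow hd (p := t - 1) (by linarith)).mul_left (τ ^ 2))
      · have := hpos k
        positivity
      · have hl := hpos k
        have hle : (1 + lam k)⁻¹ ≤ (lam k)⁻¹ := by gcongr; linarith
        rw [Real.rpow_sub hl, Real.rpow_one, div_eq_mul_inv]
        calc lam k ^ t * (τ ^ 2 * (1 + lam k)⁻¹) ≤ lam k ^ t * (τ ^ 2 * (lam k)⁻¹) := by gcongr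
          _ = _ := by ring
  -- One exponent independent of `ε` serves to construct `Φ`: `-2d` is always below `1 - d/2` and
  -- has the form `-2m` with `m = d`.
  have hweak : ∀ᵐ ξ ∂μ, Summable fun k => lam k ^ (-(2 * d : ℝ)) * a k ξ ^ 2 :=
    hsum _ (by linarith [(Nat.cast_nonneg d : (0 : ℝ) ≤ d)])
  choose T hT using fun (ξ : Ξ) (h : Summable fun k => lam k ^ (-(2 * d : ℝ)) * a k ξ ^ 2) =>
    hspec.exists_distribution hpos d h
  -- The value `0` is taken only on a null set.
  let Φ (ξ : Ξ) : 𝓓'(Ω, ℝ) :=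
    if h : Summable fun k => lam k ^ (-(2 * d : ℝ)) * a k ξ ^ 2 then T ξ h else 0
  have hΦ : ∀ᵐ ξ ∂μ, ∀ v : 𝓓(Ω, ℝ),
      HasSum (fun k => a k ξ * inner ℝ (φ k) (StochTest.testL2 v)) (Φ ξ v) := by
    filter_upwards [hweak] with ξ hξ v
    simp only [Φ, dif_pos hξ]
    exact hT ξ hξ v
  refine ⟨Φ, fun v => ?_, ?_, fun h2 ε hε => ?_⟩
  · refine aemeasurable_of_tendsto_metrizable_ae atTop
      (f := fun n ξ => ∑ k ∈ Finset.range n, a k ξ * inner ℝ (φ k) (StochTest.testL2 v))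
      (fun n => Finset.aemeasurable_fun_sum _ fun k _ =>
        (((hw_memLp k).1.aemeasurable.const_mul _).const_mul _).mul_const _) ?_
    filter_upwards [hΦ] with ξ hξ
    exact (hξ v).tendsto_sum_nat
  -- Countably many exponents give a single null set. Every `ε > 0` exceeds some `1/(m + 1)`, and
  -- summability passes to the smaller exponent.
  · have hall : ∀ᵐ ξ ∂μ, ∀ m : ℕ,
        Summable fun k => lam k ^ (1 - (d : ℝ) / 2 - 1 / ((m : ℝ) + 1)) * a k ξ ^ 2 :=
      ae_all_iff.2 fun m => hsum _ (by linarith [Nat.one_div_pos_of_nat (α := ℝ) (n := m)])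
    filter_upwards [hΦ, hall] with ξ hξ hm ε hε
    obtain ⟨m, hmε⟩ := exists_nat_one_div_lt hε
    have hconv := hspec.convergesInHdot hpos (StochTest.summable_rpow_mul_of_le hspec.mono hpos
      (fun k => sq_nonneg (a k ξ)) (s := 1 - (d : ℝ) / 2 - ε) (by linarith) (hm m)) hξ
    convert hconv using 1
    ext1 n
    simp only [StochTest.partialSum, Finset.smul_sum, smul_smul, a]
  · have : (2 : ℝ) ≤ d := by exact_mod_cast h2
    linarith
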